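/- Let $p\ge 2$ be a real number, let $m\ge 2$ be an integer, and write $S^1_m=\mathbb{R}/2m\pi\mathbb{Z}$, so that functions on $S^1_m$ are $2m\pi$-periodic functions on $\mathbb{R}$. Let $v_0\in C^\infty(S^1_m)$ be positive and satisfy $$\int_{-m\pi}^{m\pi} v_0(x)^{1-p}\,e^{ix}\,dx=0 .$$ Let $0<T_{\max}<\infty$ and let $v\in C^\infty(S^1_m\times[0,T_{\max}))$ be a positive solution of $$\frac{\partial v}{\partial t}=v^p\,(v_{xx}+v)\quad\text{on } S^1_m\times[0,T_{\max}),\qquad v(x,0)=v_0(x).$$ Put $v_{\max}(t)=\max_{x\in S^1_m}v(x,t)$. If $v_{\max}$ blows up at time $T_{\max}$, that is, $\limsup_{t\nearrow T_{\max}}v_{\max}(t)=\infty$ (so that $[0,T_{\max})$ is the maximal interval of existence of the smooth solution), then $$\lim_{t\nearrow T_{\max}}(T_{\max}-t)\,v_{\max}(t)=0 .$$ -/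

import Mathlib

open Set Filter Topology
open scoped ContDiff

/-- `v₀` is an admissible initial datum on `S_m^1 = ℝ / 2mπℤ` for the exponent `p`: smooth,
positive, `2mπ`-periodic, with `∫_{-mπ}^{mπ} v₀ ^ (1 - p) e^{ix} dx = 0`. -/
structure IsInitialDatum (p : ℝ) (m : ℕ) (v₀ : ℝ → ℝ) : Prop where
  smooth : ContDiff ℝ ∞ v₀
  periodic : Function.Periodic v₀ (2 * m * Real.pi)
  pos : ∀ x, 0 < v₀ x
  closing : ∫ x in (-(m * Real.pi))..(m * Real.pi),
    ((v₀ x ^ (1 - p) : ℝ) : ℂ) * Complex.exp (Complex.I * (x : ℂ)) = 0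

/-- `v` (written `v x t`) is a smooth positive solution, `2mπ`-periodic in `x`, of
`∂v/∂t = v ^ p (v_xx + v)` on `S_m^1 × [0, T)` with initial value `v₀`.
Only the values `v x t` with `0 ≤ t < T` are constrained; at `t = 0` the time derivative is
one-sided. -/
structure IsSmoothSolution (p : ℝ) (m : ℕ) (v₀ : ℝ → ℝ) (T : ℝ) (v : ℝ → ℝ → ℝ) : Prop where
  smooth : ContDiffOn ℝ ∞ (fun z : ℝ × ℝ => v z.1 z.2) (univ ×ˢ Ico 0 T)
  periodic : ∀ t ∈ Ico 0 T, Function.Periodic (fun x => v x t) (2 * m * Real.pi)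
  pos : ∀ x, ∀ t ∈ Ico 0 T, 0 < v x t
  initial : ∀ x, v x 0 = v₀ x
  equation : ∀ x, ∀ t ∈ Ico 0 T,
    HasDerivWithinAt (fun s => v x s)
      (v x t ^ p * (iteratedDeriv 2 (fun y => v y t) x + v x t)) (Ico 0 T) t

/-- `v_max(t)`, the maximum of `v(·, t)`; see `isGreatest_vMax` for its attainment. -/
noncomputable def vMax (v : ℝ → ℝ → ℝ) (t : ℝ) : ℝ := ⨆ x, v x t

/-- `f` blows up at `T`: `limsup_{t ↗ T} f t = ∞`. -/
def BlowsUpAt (f : ℝ → ℝ) (T : ℝ) : Prop := ∀ M : ℝ, ∃ᶠ t in 𝓝[<] T, M < f t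

/-- For a solution, the supremum defining `vMax` is a maximum. -/
theorem isGreatest_vMax {p : ℝ} {m : ℕ} (hm : 2 ≤ m) {v₀ : ℝ → ℝ} {T : ℝ} {v : ℝ → ℝ → ℝ}
    (hv : IsSmoothSolution p m v₀ T v) {t : ℝ} (ht : t ∈ Ico 0 T) :
    IsGreatest (range fun x => v x t) (vMax v t) := by
  have hc : Continuous fun x => v x t := by
    have h := hv.smooth.continuousOn.comp_continuous
      (f := fun x : ℝ => (x, t)) (by fun_prop) (fun x => ⟨mem_univ x, ht⟩)
    exact h
  have hper : (2 * m * Real.pi) ≠ 0 := by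
    have : (m : ℝ) ≠ 0 := by
      have : m ≠ 0 := by omega
      exact_mod_cast this
    have := Real.pi_ne_zero
    positivity
  exact ((hv.periodic t ht).compact_of_continuous hper hc).isGreatest_sSup (range_nonempty _)

/-! Two facts drive the proof. First, the logarithmic time derivative u = v_t / v = v^(p-1) (v_xx +
v) satisfies u_t = p u² + v^p u_xx wherever u_x = 0, so the minimum principle gives u ≥ -K
(`exists_neg_le_logDeriv`). Hence v, and with it v_max, can shrink by at most a fixed factor
(`exp_mul_le`). In particular v stays away from 0, so u ≥ -K becomes v_xx ≥ -C v_max: the profile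
cannot have a thin spike, and ∫ v ≥ c v_max (`exists_mul_vMax_le_integral`). Second, L = ∫ v^(1-p)
is nonnegative with L' = -(p-1) ∫ v (`hasDerivAt_integral_rpow`), so it decreases to a limit at
Tmax. Integrating L' from t to Tmax and using both lower bounds gives κ (Tmax - t) v_max(t) ≤ L(t) -
lim L, which tends to 0. -/

/-- The space derivative of a smooth function on `ℝ × [0, T)` is again smooth there. -/
theorem exists_contDiffOn_hasDerivAt_fst {T : ℝ} {F : ℝ × ℝ → ℝ}
    (hF : ContDiffOn ℝ ∞ F (univ ×ˢ Ico 0 T)) :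
    ∃ G : ℝ × ℝ → ℝ, ContDiffOn ℝ ∞ G (univ ×ˢ Ico 0 T) ∧
      ∀ x, ∀ t ∈ Ico 0 T, HasDerivAt (fun y => F (y, t)) (G (x, t)) x := by
  have hU : UniqueDiffOn ℝ ((univ : Set ℝ) ×ˢ Ico 0 T) :=
    uniqueDiffOn_univ.prod (uniqueDiffOn_Ico 0 T)
  refine ⟨fun z => fderivWithin ℝ F (univ ×ˢ Ico 0 T) z (1, 0), ?_, fun x t ht => ?_⟩
  · exact (hF.fderivWithin hU (m := ∞) (by simp)).clm_apply contDiffOn_const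
  · have h1 : HasFDerivWithinAt F (fderivWithin ℝ F (univ ×ˢ Ico 0 T) (x, t))
        (univ ×ˢ Ico 0 T) (x, t) :=
      ((hF.differentiableOn (by simp)) (x, t) ⟨mem_univ _, ht⟩).hasFDerivWithinAt
    have h2 : HasDerivWithinAt (fun y : ℝ => (y, t)) ((1 : ℝ), (0 : ℝ)) univ x :=
      ((hasDerivAt_id x).prodMk (hasDerivAt_const x t)).hasDerivWithinAt
    exact hasDerivWithinAt_univ.1
      (h1.comp_hasDerivWithinAt x h2 (fun y _ => (⟨mem_univ y, ht⟩ : (y, t) ∈ univ ×ˢ Ico 0 T)))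

/-- Mixed partial derivatives of a smooth function commute: the space derivative of the time
derivative is the time derivative of the space derivative. -/
theorem hasDerivAt_snd_of_hasDerivAt_fst {T : ℝ} {F Fx Ft : ℝ × ℝ → ℝ}
    (hF : ContDiffOn ℝ ∞ F (univ ×ˢ Ico 0 T))
    (hx : ∀ x, ∀ t ∈ Ioo 0 T, HasDerivAt (fun y => F (y, t)) (Fx (x, t)) x)
    (ht : ∀ x, ∀ t ∈ Ioo 0 T, HasDerivAt (fun s => F (x, s)) (Ft (x, t)) t)
    {x t a : ℝ} (hmem : t ∈ Ioo 0 T) (ha : HasDerivAt (fun y => Ft (y, t)) a x) :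
    HasDerivAt (fun s => Fx (x, s)) a t := by
  have hat : ∀ y, ∀ s ∈ Ioo 0 T, ContDiffAt ℝ ∞ F (y, s) := fun y s hs =>
    hF.contDiffAt (prod_mem_nhds univ_mem (Ico_mem_nhds hs.1 hs.2))
  have hline1 : ∀ y s : ℝ, HasDerivAt (fun y : ℝ => (y, s)) ((1 : ℝ), (0 : ℝ)) y :=
    fun y s => (hasDerivAt_id y).prodMk (hasDerivAt_const y s)
  have hline2 : ∀ y s : ℝ, HasDerivAt (fun s : ℝ => (y, s)) ((0 : ℝ), (1 : ℝ)) s :=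
    fun y s => (hasDerivAt_const s y).prodMk (hasDerivAt_id s)
  have hd : ∀ y, ∀ s ∈ Ioo 0 T, HasFDerivAt F (fderiv ℝ F (y, s)) (y, s) := fun y s hs =>
    ((hat y s hs).differentiableAt (by simp)).hasFDerivAt
  have hFx : ∀ y, ∀ s ∈ Ioo 0 T, Fx (y, s) = fderiv ℝ F (y, s) (1, 0) := fun y s hs =>
    (hx y s hs).unique ((hd y s hs).comp_hasDerivAt y (hline1 y s))
  have hFt : ∀ y, ∀ s ∈ Ioo 0 T, Ft (y, s) = fderiv ℝ F (y, s) (0, 1) := fun y s hs =>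
    (ht y s hs).unique ((hd y s hs).comp_hasDerivAt s (hline2 y s))
  have h2 : HasFDerivAt (fderiv ℝ F) (fderiv ℝ (fderiv ℝ F) (x, t)) (x, t) :=
    (((hat x t hmem).fderiv_right (m := 1) (by norm_cast)).differentiableAt
      (by simp)).hasFDerivAt
  have hsymm := (hat x t hmem).isSymmSndFDerivAt (by simpa using by norm_cast)
  have happ : ∀ w : ℝ × ℝ, HasFDerivAt (fun z => fderiv ℝ F z w)
      ((ContinuousLinearMap.apply ℝ ℝ w).comp (fderiv ℝ (fderiv ℝ F) (x, t))) (x, t) :=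
    fun w => (ContinuousLinearMap.apply ℝ ℝ w).hasFDerivAt.comp (x, t) h2
  have e0 : HasDerivAt (fun y => Ft (y, t)) (fderiv ℝ (fderiv ℝ F) (x, t) (1, 0) (0, 1)) x := by
    have h4 : HasDerivAt (fun y => fderiv ℝ F (y, t) (0, 1))
        (fderiv ℝ (fderiv ℝ F) (x, t) (1, 0) (0, 1)) x := by
      have := (happ (0, 1)).comp_hasDerivAt x (hline1 x t)
      exact this
    exact h4.congr_of_eventuallyEq (Eventually.of_forall fun y => hFt y t hmem)
  have h3 : HasDerivAt (fun s => fderiv ℝ F (x, s) (1, 0))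
      (fderiv ℝ (fderiv ℝ F) (x, t) (0, 1) (1, 0)) t := by
    have := (happ (1, 0)).comp_hasDerivAt t (hline2 x t)
    exact this
  rw [ha.unique e0, hsymm.eq]
  refine h3.congr_of_eventuallyEq ?_
  filter_upwards [Ioo_mem_nhds hmem.1 hmem.2] with s hs using hFx x s hs

/-! ### Minimum principle -/

/-- The second derivative at a global minimum is nonnegative. -/
theorem nonneg_of_hasDerivAt_of_forall_le {f f' : ℝ → ℝ} {x₀ c : ℝ}
    (hf : ∀ x, HasDerivAt f (f' x) x) (hc : HasDerivAt f' c x₀) (hmin : ∀ x, f x₀ ≤ f x) :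
    0 ≤ c := by
  by_contra! hneg
  have hd : deriv f = f' := funext fun x => (hf x).deriv
  have hloc : IsLocalMin f x₀ := Eventually.of_forall hmin
  -- If c < 0 the point is a local maximum as well as a minimum, so f is locally constant and c = 0.
  have hmax : IsLocalMax f x₀ := isLocalMax_of_deriv_deriv_neg (by rwa [hd, hc.deriv])
    hloc.deriv_eq_zero (hf x₀).continuousAt
  have heq : f =ᶠ[𝓝 x₀] fun _ => f x₀ := by
    filter_upwards [hmax] with x hx using le_antisymm hx (hmin x)
  have h0 : f' =ᶠ[𝓝 x₀] fun _ => 0 := by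
    have := heq.deriv
    rw [hd] at this
    simpa using this
  have : c = 0 := hc.unique ((hasDerivAt_const x₀ (0 : ℝ)).congr_of_eventuallyEq h0)
  linarith

/-- The minimum principle for functions that are periodic in space. -/
theorem le_of_le_initial_of_periodic {T P K : ℝ} (hP : 0 < P) {u ux uxx : ℝ × ℝ → ℝ}
    (hu : ContinuousOn u (univ ×ˢ Ico 0 T))
    (hper : ∀ t ∈ Ico 0 T, Function.Periodic (fun x => u (x, t)) P)
    (hux : ∀ x, ∀ t ∈ Ioo 0 T, HasDerivAt (fun y => u (y, t)) (ux (x, t)) x)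
    (huxx : ∀ x, ∀ t ∈ Ioo 0 T, HasDerivAt (fun y => ux (y, t)) (uxx (x, t)) x)
    (hut : ∀ x, ∀ t ∈ Ioo 0 T, ux (x, t) = 0 → 0 ≤ uxx (x, t) →
      ∃ d, 0 ≤ d ∧ HasDerivAt (fun s => u (x, s)) d t)
    (hK : ∀ x, K ≤ u (x, 0)) : ∀ x, ∀ t ∈ Ico 0 T, K ≤ u (x, t) := by
  intro x t ht
  -- The term ε * t makes the time derivative strictly positive at a spatial minimum, where `hut`
  -- only gives a nonnegative one.
  suffices h : ∀ ε > 0, K ≤ u (x, t) + ε * t by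
    refine le_of_forall_pos_le_add fun δ hδ => ?_
    have h1 := h (δ / (t + 1)) (div_pos hδ (by linarith [ht.1]))
    have h2 : δ / (t + 1) * t ≤ δ := by
      rw [div_mul_eq_mul_div, div_le_iff₀ (by linarith [ht.1])]
      nlinarith [ht.1]
    linarith
  intro ε hε
  have hsub : Icc 0 P ×ˢ Icc 0 t ⊆ (univ : Set ℝ) ×ˢ Ico 0 T := fun z hz =>
    ⟨mem_univ _, hz.2.1, hz.2.2.trans_lt ht.2⟩
  have hcont : ContinuousOn (fun z : ℝ × ℝ => u z + ε * z.2) (Icc 0 P ×ˢ Icc 0 t) :=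
    (hu.mono hsub).add (by fun_prop)
  obtain ⟨⟨x₁, t₁⟩, ⟨hx₁, ht₁⟩, hmin⟩ := (isCompact_Icc.prod isCompact_Icc).exists_isMinOn
    (⟨(0, 0), ⟨le_rfl, hP.le⟩, le_rfl, ht.1⟩ : (Icc 0 P ×ˢ Icc 0 t : Set (ℝ × ℝ)).Nonempty) hcont
  have hmin' : ∀ y, ∀ s ∈ Icc 0 t, u (x₁, t₁) + ε * t₁ ≤ u (y, s) + ε * s := by
    intro y s hs
    obtain ⟨y', hy', he⟩ := (hper s ⟨hs.1, hs.2.trans_lt ht.2⟩).exists_mem_Ico₀ hP y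
    have := hmin (show (y', s) ∈ Icc 0 P ×ˢ Icc 0 t from ⟨Ico_subset_Icc_self hy', hs⟩)
    simp only [mem_ofPred_eq] at this he
    linarith
  refine le_trans ?_ (hmin' x t ⟨ht.1, le_rfl⟩)
  rcases ht₁.1.eq_or_lt with h0 | h0
  · simp only at h0
    rw [← h0]
    simpa using hK x₁
  exfalso
  have hI : t₁ ∈ Ioo 0 T := ⟨h0, ht₁.2.trans_lt ht.2⟩
  have hspace : ∀ y, u (x₁, t₁) ≤ u (y, t₁) := fun y => by linarith [hmin' y t₁ ht₁]
  have hloc : IsLocalMin (fun y => u (y, t₁)) x₁ := Eventually.of_forall hspace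
  have hx0 := hloc.hasDerivAt_eq_zero (hux x₁ t₁ hI)
  have hxx := nonneg_of_hasDerivAt_of_forall_le (fun y => hux y t₁ hI) (huxx x₁ t₁ hI) hspace
  obtain ⟨d, hd0, hd⟩ := hut x₁ t₁ hI hx0 hxx
  have hg : HasDerivAt (fun s => u (x₁, s) + ε * s) (d + ε) t₁ := by
    exact (hd.add ((hasDerivAt_id t₁).const_mul ε)).congr_deriv (by simp)
  -- Only slopes from the left are available: t₁ may be the final time t of the compact slab.
  have hneg : d + ε ≤ 0 := by
    have hs := hg.hasDerivWithinAt (s := Iio t₁)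
    rw [hasDerivWithinAt_iff_tendsto_slope' (by simp)] at hs
    refine le_of_tendsto hs ?_
    filter_upwards [Ioo_mem_nhdsLT h0] with s hs
    rw [slope_def_field]
    exact div_nonpos_of_nonneg_of_nonpos
      (by linarith [hmin' x₁ s ⟨hs.1.le, hs.2.le.trans ht₁.2⟩]) (by linarith [hs.2])
  linarith

/-! ### Integrals, concavity and periodicity -/

/-- Differentiation under the integral sign for jointly continuous derivatives. -/
theorem hasDerivAt_integral_of_continuousOn {T a b : ℝ} {f f' : ℝ × ℝ → ℝ}
    (hf : ContinuousOn f (univ ×ˢ Ico 0 T)) (hf' : ContinuousOn f' (univ ×ˢ Ico 0 T))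
    (hd : ∀ x, ∀ t ∈ Ioo 0 T, HasDerivAt (fun s => f (x, s)) (f' (x, t)) t)
    {t : ℝ} (ht : t ∈ Ioo 0 T) :
    HasDerivAt (fun s => ∫ x in a..b, f (x, s)) (∫ x in a..b, f' (x, t)) t := by
  have hline : ∀ {g : ℝ × ℝ → ℝ}, ContinuousOn g (univ ×ˢ Ico 0 T) → ∀ s ∈ Ioo 0 T,
      Continuous fun x => g (x, s) := fun hg s hs =>
    hg.comp_continuous (f := fun x : ℝ => (x, s)) (by fun_prop)
      (fun x => ⟨mem_univ x, hs.1.le, hs.2⟩)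
  obtain ⟨t₀, h0, h0t⟩ := exists_between ht.1
  obtain ⟨t₁, ht1, h1T⟩ := exists_between ht.2
  have hsub : uIcc a b ×ˢ Icc t₀ t₁ ⊆ (univ : Set ℝ) ×ˢ Ico 0 T := fun z hz =>
    ⟨mem_univ _, h0.le.trans hz.2.1, hz.2.2.trans_lt h1T⟩
  obtain ⟨C, hC⟩ := (isCompact_uIcc.prod isCompact_Icc).exists_bound_of_continuousOn
    (hf'.mono hsub)
  refine (intervalIntegral.hasDerivAt_integral_of_dominated_loc_of_deriv_le
    (F := fun s x => f (x, s)) (F' := fun s x => f' (x, s)) (bound := fun _ => C)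
    (s := Icc t₀ t₁) (Icc_mem_nhds h0t ht1) ?_ ?_ ?_ ?_ ?_ ?_).2
  · filter_upwards [Ioo_mem_nhds ht.1 ht.2] with s hs using
      (hline hf s hs).aestronglyMeasurable
  · exact (hline hf t ht).intervalIntegrable _ _
  · exact (hline hf' t ht).aestronglyMeasurable
  · exact Eventually.of_forall fun x hx s hs => hC (x, s) ⟨uIoc_subset_uIcc hx, hs⟩
  · exact intervalIntegrable_const
  · exact Eventually.of_forall fun x _ s hs =>
      hd x s ⟨h0.trans_le hs.1, hs.2.trans_lt h1T⟩

/-- A function whose second derivative is at least `-A` lies above the corresponding parabola to the right of a critical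
point. -/
theorem sub_le_of_neg_le_deriv2 {f f' f'' : ℝ → ℝ} {A x₀ : ℝ}
    (hf : ∀ x, HasDerivAt f (f' x) x) (hf' : ∀ x, HasDerivAt f' (f'' x) x)
    (hA : ∀ x, -A ≤ f'' x) (h0 : f' x₀ = 0) {x : ℝ} (hx : x₀ ≤ x) :
    f x₀ - A * (x - x₀) ^ 2 / 2 ≤ f x := by
  have h1 : ∀ y, HasDerivAt (fun y => f' y + A * (y - x₀)) (f'' y + A) y := fun y => by
    exact ((hf' y).add (((hasDerivAt_id y).sub_const x₀).const_mul A)).congr_deriv (by simp)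
  have h2 : ∀ y, HasDerivAt (fun y => f y + A * (y - x₀) ^ 2 / 2) (f' y + A * (y - x₀)) y :=
    fun y => by
      have := (hf y).add (((((hasDerivAt_id y).sub_const x₀).pow 2).const_mul A).div_const 2)
      refine this.congr_deriv ?_
      simp
      ring
  have hm1 : Monotone fun y => f' y + A * (y - x₀) :=
    monotone_of_deriv_nonneg (fun y => (h1 y).differentiableAt)
      (fun y => by rw [(h1 y).deriv]; linarith [hA y])
  have hm2 : MonotoneOn (fun y => f y + A * (y - x₀) ^ 2 / 2) (Ici x₀) := by
    refine monotoneOn_of_deriv_nonneg (convex_Ici x₀)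
      (fun y _ => (h2 y).continuousAt.continuousWithinAt)
      (fun y _ => (h2 y).differentiableAt.differentiableWithinAt) fun y hy => ?_
    rw [interior_Ici] at hy
    rw [(h2 y).deriv]
    have := hm1 (le_of_lt (mem_Ioi.1 hy))
    simpa [h0] using this
  have := hm2 self_mem_Ici (mem_Ici.2 hx) hx
  simp at this
  linarith

/-- The derivative of a periodic function is periodic. -/
theorem Function.Periodic.of_hasDerivAt {f f' : ℝ → ℝ} {c : ℝ}
    (hf : Function.Periodic f c) (h : ∀ x, HasDerivAt f (f' x) x) : Function.Periodic f' c := by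
  intro x
  have h1 : HasDerivAt (fun y => f (y + c)) (f' (x + c)) x := (h (x + c)).comp_add_const x c
  rw [show (fun y => f (y + c)) = f from funext hf] at h1
  exact h1.unique (h x)

/-- An interval of length at most 1 then fits inside one period. -/
theorem one_le_period {m : ℕ} (hm : 2 ≤ m) : 1 ≤ 2 * (m : ℝ) * Real.pi := by
  have : (2 : ℝ) ≤ m := by exact_mod_cast hm
  nlinarith [Real.pi_gt_three]

/-! ### A priori estimates along the flow -/

namespace IsSmoothSolution

variable {p : ℝ} {m : ℕ} {v₀ : ℝ → ℝ} {T : ℝ} {v : ℝ → ℝ → ℝ}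

/-- The first two space derivatives of a solution are smooth up to the initial time. -/
theorem exists_space_derivs (hv : IsSmoothSolution p m v₀ T v) :
    ∃ vx vxx : ℝ × ℝ → ℝ,
      ContDiffOn ℝ ∞ vx (univ ×ˢ Ico 0 T) ∧ ContDiffOn ℝ ∞ vxx (univ ×ˢ Ico 0 T) ∧
      (∀ x, ∀ t ∈ Ico 0 T, HasDerivAt (fun y => v y t) (vx (x, t)) x) ∧
      (∀ x, ∀ t ∈ Ico 0 T, HasDerivAt (fun y => vx (y, t)) (vxx (x, t)) x) ∧
      ∀ x, ∀ t ∈ Ico 0 T,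
        HasDerivWithinAt (fun s => v x s) (v x t ^ p * (vxx (x, t) + v x t)) (Ico 0 T) t := by
  obtain ⟨vx, hvx, h1⟩ := exists_contDiffOn_hasDerivAt_fst hv.smooth
  obtain ⟨vxx, hvxx, h2⟩ := exists_contDiffOn_hasDerivAt_fst hvx
  refine ⟨vx, vxx, hvx, hvxx, h1, h2, fun x t ht => ?_⟩
  have e : deriv (fun y => v y t) = fun y => vx (y, t) := funext fun y => (h1 y t ht).deriv
  have := hv.equation x t ht
  rwa [iteratedDeriv_succ, iteratedDeriv_one, e, (h2 x t ht).deriv] at this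

/-- The logarithmic time derivative of a solution, `v ^ (p - 1) * (v_xx + v)`, is bounded from
below, by the minimum principle. -/
theorem exists_neg_le_logDeriv (hp : 2 ≤ p) (hm : 2 ≤ m) (hT : 0 < T)
    (hv : IsSmoothSolution p m v₀ T v) {vx vxx : ℝ × ℝ → ℝ}
    (hvx : ContDiffOn ℝ ∞ vx (univ ×ˢ Ico 0 T)) (hvxx : ContDiffOn ℝ ∞ vxx (univ ×ˢ Ico 0 T))
    (h1 : ∀ x, ∀ t ∈ Ico 0 T, HasDerivAt (fun y => v y t) (vx (x, t)) x)
    (h2 : ∀ x, ∀ t ∈ Ico 0 T, HasDerivAt (fun y => vx (y, t)) (vxx (x, t)) x)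
    (ht : ∀ x, ∀ t ∈ Ico 0 T,
      HasDerivWithinAt (fun s => v x s) (v x t ^ p * (vxx (x, t) + v x t)) (Ico 0 T) t) :
    ∃ K, 0 ≤ K ∧ ∀ x, ∀ t ∈ Ico 0 T, -K ≤ v x t ^ (p - 1) * (vxx (x, t) + v x t) := by
  have hP : 0 < 2 * (m : ℝ) * Real.pi := by linarith [one_le_period hm]
  -- The equation reads v_t = u v, which keeps the mixed derivatives below simple.
  set u : ℝ × ℝ → ℝ := fun z => v z.1 z.2 ^ (p - 1) * (vxx z + v z.1 z.2) with hu
  have huS : ContDiffOn ℝ ∞ u (univ ×ˢ Ico 0 T) :=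
    (hv.smooth.rpow_const_of_ne fun z hz => (hv.pos z.1 z.2 hz.2).ne').mul
      (hvxx.add hv.smooth)
  have hI : ∀ t ∈ Ioo 0 T, t ∈ Ico 0 T := fun t h => Ioo_subset_Ico_self h
  obtain ⟨ux, huxS, hux⟩ := exists_contDiffOn_hasDerivAt_fst huS
  obtain ⟨uxx, -, huxx⟩ := exists_contDiffOn_hasDerivAt_fst huxS
  have hper : ∀ t ∈ Ico 0 T, Function.Periodic (fun x => u (x, t)) (2 * m * Real.pi) := by
    intro t ht x
    have e1 := hv.periodic t ht x
    have e2 := ((hv.periodic t ht).of_hasDerivAt (fun x => h1 x t ht)).of_hasDerivAt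
      (fun x => h2 x t ht) x
    simp only [hu] at e1 e2 ⊢
    rw [e1, e2]
  have hvt : ∀ x, ∀ t ∈ Ioo 0 T, HasDerivAt (fun s => v x s) (u (x, t) * v x t) t := by
    intro x t h
    refine ((ht x t (hI t h)).hasDerivAt (Ico_mem_nhds h.1 h.2)).congr_deriv ?_
    have hpos := hv.pos x t (hI t h)
    rw [show p = (p - 1) + 1 by ring, Real.rpow_add_one hpos.ne']
    simp only [hu]
    ring_nf
  have hvxt : ∀ x, ∀ t ∈ Ioo 0 T, HasDerivAt (fun s => vx (x, s))
      (ux (x, t) * v x t + u (x, t) * vx (x, t)) t := fun x t h =>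
    hasDerivAt_snd_of_hasDerivAt_fst (F := fun z => v z.1 z.2)
      (Ft := fun z => u z * v z.1 z.2) hv.smooth (fun x t h => h1 x t (hI t h)) hvt h
      ((hux x t (hI t h)).mul (h1 x t (hI t h)))
  have hvxxt : ∀ x, ∀ t ∈ Ioo 0 T, HasDerivAt (fun s => vxx (x, s))
      ((uxx (x, t) * v x t + ux (x, t) * vx (x, t)) +
        (ux (x, t) * vx (x, t) + u (x, t) * vxx (x, t))) t := fun x t h =>
    hasDerivAt_snd_of_hasDerivAt_fst (F := vx)
      (Ft := fun z => ux z * v z.1 z.2 + u z * vx z) hvx (fun x t h => h2 x t (hI t h)) hvxt h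
      (((huxx x t (hI t h)).mul (h1 x t (hI t h))).add
        ((hux x t (hI t h)).mul (h2 x t (hI t h))))
  have h0 : (0 : ℝ) ∈ Ico 0 T := ⟨le_rfl, hT⟩
  have hu0 : Continuous fun x => u (x, 0) :=
    huS.continuousOn.comp_continuous (f := fun x : ℝ => (x, (0 : ℝ))) (by fun_prop)
      (fun x => ⟨mem_univ x, h0⟩)
  obtain ⟨B, hB⟩ := ((hper 0 h0).compact_of_continuous hP.ne' hu0).bddBelow
  refine ⟨max 0 (-B), le_max_left _ _, le_of_le_initial_of_periodic hP huS.continuousOn hper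
    (fun x t h => hux x t (hI t h)) (fun x t h => huxx x t (hI t h)) ?_ fun x => ?_⟩
  · intro x t h hx0 hxx
    have hpos := hv.pos x t (hI t h)
    refine ⟨_, ?_, ((hvt x t h).rpow_const (p := p - 1) (Or.inl hpos.ne')).mul
      ((hvxxt x t h).add (hvt x t h))⟩
    have e : v x t ^ (p - 1) = v x t ^ (p - 1 - 1) * v x t := by
      rw [← Real.rpow_add_one hpos.ne']
      ring_nf
    have hw : 0 < v x t ^ (p - 1 - 1) := Real.rpow_pos_of_pos hpos _
    have hue : u (x, t) = v x t ^ (p - 1 - 1) * v x t * (vxx (x, t) + v x t) := by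
      simp only [hu, e]
    rw [hx0, e]
    -- With u_x = 0 inserted, the time derivative of u is p u² + v^p u_xx.
    have : u (x, t) * v x t * (p - 1) * v x t ^ (p - 1 - 1) * (vxx (x, t) + v x t) +
        v x t ^ (p - 1 - 1) * v x t * (uxx (x, t) * v x t + 0 * vx (x, t) +
          (0 * vx (x, t) + u (x, t) * vxx (x, t)) + u (x, t) * v x t) =
        p * u (x, t) ^ 2 + v x t ^ (p - 1 - 1) * v x t ^ 2 * uxx (x, t) := by
      rw [hue]
      ring
    rw [this]
    have : 0 ≤ p := by linarith
    positivity
  · have hBx : B ≤ u (x, 0) := hB (mem_range_self x)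
    linarith [le_max_right 0 (-B)]

/-- A lower bound on the logarithmic time derivative bounds the decay of a solution. -/
theorem exp_mul_le (hv : IsSmoothSolution p m v₀ T v) {vxx : ℝ × ℝ → ℝ} {K : ℝ} (hK : 0 ≤ K)
    (ht : ∀ x, ∀ t ∈ Ico 0 T,
      HasDerivWithinAt (fun s => v x s) (v x t ^ p * (vxx (x, t) + v x t)) (Ico 0 T) t)
    (hle : ∀ x, ∀ t ∈ Ico 0 T, -K ≤ v x t ^ (p - 1) * (vxx (x, t) + v x t))
    (x : ℝ) {t s : ℝ} (ht0 : 0 ≤ t) (hts : t ≤ s) (hs : s < T) :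
    Real.exp (-(K * T)) * v x t ≤ v x s := by
  have hd : ∀ r ∈ Ico 0 T, HasDerivWithinAt (fun r => v x r * Real.exp (K * r))
      (v x r ^ p * (vxx (x, r) + v x r) * Real.exp (K * r) +
        v x r * (Real.exp (K * r) * (K * 1))) (Ico 0 T) r := fun r hr =>
    (ht x r hr).mul ((((hasDerivAt_id r).const_mul K).exp).hasDerivWithinAt)
  -- The integrating factor exp (K r) turns v_t ≥ -K v into monotonicity.
  have hmono : MonotoneOn (fun r => v x r * Real.exp (K * r)) (Ico 0 T) := by
    refine monotoneOn_of_hasDerivWithinAt_nonneg (convex_Ico 0 T)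
      (fun r hr => (hd r hr).continuousWithinAt)
      (fun r hr => (hd r (interior_subset hr)).mono interior_subset) fun r hr => ?_
    have hr' := interior_subset hr
    have hpos := hv.pos x r hr'
    have h := hle x r hr'
    have e : v x r ^ p = v x r ^ (p - 1) * v x r := by
      rw [← Real.rpow_add_one hpos.ne']
      ring_nf
    have : v x r ^ p * (vxx (x, r) + v x r) * Real.exp (K * r) +
        v x r * (Real.exp (K * r) * (K * 1)) =
        Real.exp (K * r) * v x r * (v x r ^ (p - 1) * (vxx (x, r) + v x r) + K) := by
      rw [e]
      ring
    rw [this]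
    exact mul_nonneg (by positivity) (by linarith)
  have h := hmono ⟨ht0, hts.trans_lt hs⟩ ⟨ht0.trans hts, hs⟩ hts
  simp only at h
  have hvt := hv.pos x t ⟨ht0, hts.trans_lt hs⟩
  have hvs := hv.pos x s ⟨ht0.trans hts, hs⟩
  have h1 : (1 : ℝ) ≤ Real.exp (K * t) := Real.one_le_exp (by positivity)
  have h2 : Real.exp (K * s) ≤ Real.exp (K * T) := Real.exp_le_exp.2 (by gcongr)
  rw [Real.exp_neg, inv_mul_le_iff₀ (Real.exp_pos _)]
  nlinarith

/-- The mean of a solution controls its maximum. -/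
theorem exists_mul_vMax_le_integral (hm : 2 ≤ m) (hT : 0 < T)
    (hv : IsSmoothSolution p m v₀ T v) {vx vxx : ℝ × ℝ → ℝ}
    (h1 : ∀ x, ∀ t ∈ Ico 0 T, HasDerivAt (fun y => v y t) (vx (x, t)) x)
    (h2 : ∀ x, ∀ t ∈ Ico 0 T, HasDerivAt (fun y => vx (y, t)) (vxx (x, t)) x)
    (hp : 2 ≤ p) {K δ : ℝ} (hK : 0 ≤ K) (hδ : 0 < δ)
    (hle : ∀ x, ∀ t ∈ Ico 0 T, -K ≤ v x t ^ (p - 1) * (vxx (x, t) + v x t))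
    (hlow : ∀ x, ∀ t ∈ Ico 0 T, δ * v x 0 ≤ v x t) :
    ∃ c, 0 < c ∧ ∀ t ∈ Ico 0 T, c * vMax v t ≤ ∫ x in 0..2 * m * Real.pi, v x t := by
  have hP1 := one_le_period hm
  have hP : 0 < 2 * (m : ℝ) * Real.pi := by linarith
  have h0 : (0 : ℝ) ∈ Ico 0 T := ⟨le_rfl, hT⟩
  have hcont : ∀ t ∈ Ico 0 T, Continuous fun x => v x t := fun t ht =>
    continuous_iff_continuousAt.2 fun x => (h1 x t ht).continuousAt
  obtain ⟨x₀, hx₀⟩ : ∃ x₀, ∀ x, v x₀ 0 ≤ v x 0 := by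
    obtain ⟨-, ⟨x₀, rfl⟩, h⟩ := ((hv.periodic 0 h0).compact_of_continuous hP.ne'
      (hcont 0 h0)).exists_isLeast (range_nonempty _)
    exact ⟨x₀, fun x => h (mem_range_self x)⟩
  set c₀ := δ * v x₀ 0 with hc₀
  have hc₀pos : 0 < c₀ := mul_pos hδ (hv.pos x₀ 0 h0)
  have hc₀le : ∀ x, ∀ t ∈ Ico 0 T, c₀ ≤ v x t := fun x t ht =>
    (mul_le_mul_of_nonneg_left (hx₀ x) hδ.le).trans (hlow x t ht)
  -- From v_xx ≥ -v - K v^(1-p) and v^(1-p) = v^(-p) v ≤ c₀^(-p) M, where c₀ bounds v from below.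
  set C := 1 + K * c₀ ^ (-p) with hC
  have hC1 : 1 ≤ C := by
    have := Real.rpow_pos_of_pos hc₀pos (-p)
    have : 0 ≤ K * c₀ ^ (-p) := by positivity
    linarith
  -- Height M / 2 times width 1 / C.
  refine ⟨1 / (2 * C), by positivity, fun t ht => ?_⟩
  obtain ⟨⟨x₁, hx₁⟩, hmax⟩ := isGreatest_vMax hm hv ht
  simp only at hx₁
  set M := vMax v t
  have hle_M : ∀ x, v x t ≤ M := fun x => hmax (mem_range_self x)
  have hMpos : 0 < M := hx₁ ▸ hv.pos x₁ t ht
  have hxx : ∀ x, -(C * M) ≤ vxx (x, t) := by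
    intro x
    have hpos := hv.pos x t ht
    have hw : 0 < v x t ^ (p - 1) := Real.rpow_pos_of_pos hpos _
    have hmono : v x t ^ (-p) ≤ c₀ ^ (-p) :=
      Real.rpow_le_rpow_of_nonpos hc₀pos (hc₀le x t ht) (by linarith)
    have e : v x t ^ (p - 1) * (v x t ^ (-p) * v x t) = 1 := by
      rw [← Real.rpow_add_one hpos.ne', ← Real.rpow_add hpos]
      ring_nf
      exact Real.rpow_zero _
    have h3 : -(K * (v x t ^ (-p) * v x t)) ≤ vxx (x, t) + v x t := by
      by_contra! hlt
      have h4 := mul_lt_mul_of_pos_left hlt hw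
      have h5 : v x t ^ (p - 1) * -(K * (v x t ^ (-p) * v x t)) = -K := by
        linear_combination (-K) * e
      linarith [hle x t ht]
    have h6 : v x t ^ (-p) * v x t ≤ c₀ ^ (-p) * M :=
      mul_le_mul hmono (hle_M x) hpos.le (Real.rpow_pos_of_pos hc₀pos _).le
    have h7 := mul_le_mul_of_nonneg_left h6 hK
    have : C * M = M + K * (c₀ ^ (-p) * M) := by rw [hC]; ring
    linarith [hle_M x]
  have hcrit : vx (x₁, t) = 0 :=
    IsLocalMax.hasDerivAt_eq_zero
      (Eventually.of_forall fun y => (hle_M y).trans hx₁.ge : IsLocalMax (fun y => v y t) x₁)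
      (h1 x₁ t ht)
  have hhalf : ∀ x ∈ Icc x₁ (x₁ + 1 / C), M / 2 ≤ v x t := by
    intro x hx
    have h := sub_le_of_neg_le_deriv2 (fun y => h1 y t ht) (fun y => h2 y t ht) hxx hcrit hx.1
    rw [hx₁] at h
    have hd : 0 ≤ x - x₁ := by linarith [hx.1]
    have hd1 : C * (x - x₁) ≤ 1 := by
      have : x - x₁ ≤ 1 / C := by linarith [hx.2]
      rwa [le_div_iff₀ (by linarith), mul_comm] at this
    -- C ≥ 1 enters here: C d ≤ 1 forces d ≤ 1, so the parabola loses at most M / 2.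
    have hd2 : C * (x - x₁) ^ 2 ≤ 1 := by nlinarith
    nlinarith
  have hC' : 1 / C ≤ 1 := by
    rw [div_le_one (by linarith)]
    exact hC1
  have hC0 : 0 < 1 / C := by positivity
  calc 1 / (2 * C) * M = ∫ _ in x₁..(x₁ + 1 / C), M / 2 := by
        rw [intervalIntegral.integral_const]
        simp
        ring
    _ ≤ ∫ x in x₁..(x₁ + 1 / C), v x t :=
        intervalIntegral.integral_mono_on (by linarith) intervalIntegrable_const
          ((hcont t ht).intervalIntegrable _ _) hhalf
    _ ≤ ∫ x in x₁..(x₁ + 2 * m * Real.pi), v x t :=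
        intervalIntegral.integral_mono_interval le_rfl (by linarith) (by linarith)
          (Eventually.of_forall fun x => (hv.pos x t ht).le)
          ((hcont t ht).intervalIntegrable _ _)
    _ = ∫ x in 0..2 * m * Real.pi, v x t := by
        have := (hv.periodic t ht).intervalIntegral_add_eq x₁ 0
        rwa [zero_add] at this

/-- The integral of `v ^ (1 - p)` decreases at the rate `(p - 1) ∫ v`. -/
theorem hasDerivAt_integral_rpow (hv : IsSmoothSolution p m v₀ T v) {vx vxx : ℝ × ℝ → ℝ}
    (hvxx : ContDiffOn ℝ ∞ vxx (univ ×ˢ Ico 0 T))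
    (h1 : ∀ x, ∀ t ∈ Ico 0 T, HasDerivAt (fun y => v y t) (vx (x, t)) x)
    (h2 : ∀ x, ∀ t ∈ Ico 0 T, HasDerivAt (fun y => vx (y, t)) (vxx (x, t)) x)
    (ht : ∀ x, ∀ t ∈ Ico 0 T,
      HasDerivWithinAt (fun s => v x s) (v x t ^ p * (vxx (x, t) + v x t)) (Ico 0 T) t)
    {t : ℝ} (htm : t ∈ Ioo 0 T) :
    HasDerivAt (fun s => ∫ x in 0..2 * m * Real.pi, v x s ^ (1 - p))
      ((1 - p) * ∫ x in 0..2 * m * Real.pi, v x t) t := by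
  have hI : ∀ t ∈ Ioo 0 T, t ∈ Ico 0 T := fun t h => Ioo_subset_Ico_self h
  have hline : ∀ {g : ℝ × ℝ → ℝ}, ContDiffOn ℝ ∞ g (univ ×ˢ Ico 0 T) →
      Continuous fun x => g (x, t) := fun hg =>
    hg.continuousOn.comp_continuous (f := fun x : ℝ => (x, t)) (by fun_prop)
      (fun x => ⟨mem_univ x, hI t htm⟩)
  have key := hasDerivAt_integral_of_continuousOn (a := 0) (b := 2 * m * Real.pi)
    (f := fun z => v z.1 z.2 ^ (1 - p)) (f' := fun z => (1 - p) * (vxx z + v z.1 z.2))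
    (hv.smooth.rpow_const_of_ne fun z hz => (hv.pos z.1 z.2 hz.2).ne').continuousOn
    (contDiffOn_const.mul (hvxx.add hv.smooth)).continuousOn
    (fun x s hs => by
      have hpos := hv.pos x s (hI s hs)
      refine (((ht x s (hI s hs)).hasDerivAt (Ico_mem_nhds hs.1 hs.2)).rpow_const
        (p := 1 - p) (Or.inl hpos.ne')).congr_deriv ?_
      have e : v x s ^ p * v x s ^ (1 - p - 1) = 1 := by
        rw [← Real.rpow_add hpos]
        ring_nf
        exact Real.rpow_zero _
      linear_combination (1 - p) * (vxx (x, s) + v x s) * e) htm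
  refine key.congr_deriv ?_
  -- The diffusion term is an exact derivative of a periodic function.
  have hxx0 : ∫ x in 0..2 * m * Real.pi, vxx (x, t) = 0 := by
    rw [intervalIntegral.integral_eq_sub_of_hasDerivAt (fun x _ => h2 x t (hI t htm))
      ((hline hvxx).intervalIntegrable _ _)]
    have := ((hv.periodic t (hI t htm)).of_hasDerivAt (fun x => h1 x t (hI t htm))) 0
    simp only [zero_add] at this
    rw [this, sub_self]
  rw [intervalIntegral.integral_const_mul, intervalIntegral.integral_add
    ((hline hvxx).intervalIntegrable _ _) ((hline hv.smooth).intervalIntegrable _ _), hxx0,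
    zero_add]

end IsSmoothSolution

/-! ### Conclusion by integrating L up to Tmax -/

theorem theorem2p4 (p : ℝ) (hp : 2 ≤ p) (m : ℕ) (hm : 2 ≤ m)
    (v₀ : ℝ → ℝ) (hv₀ : IsInitialDatum p m v₀)
    (Tmax : ℝ) (hT : 0 < Tmax)
    (v : ℝ → ℝ → ℝ) (hv : IsSmoothSolution p m v₀ Tmax v)
    (hblow : BlowsUpAt (vMax v) Tmax) :
    Tendsto (fun t => (Tmax - t) * vMax v t) (𝓝[<] Tmax) (𝓝 0) := by
  obtain ⟨vx, vxx, hvx, hvxx, h1, h2, ht⟩ := hv.exists_space_derivs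
  obtain ⟨K, hK, hle⟩ := hv.exists_neg_le_logDeriv hp hm hT hvx hvxx h1 h2 ht
  have hgrow := fun x t s => hv.exp_mul_le hK ht hle x (t := t) (s := s)
  set δ := Real.exp (-(K * Tmax))
  have hδ : 0 < δ := Real.exp_pos _
  obtain ⟨c, hc, hint⟩ := hv.exists_mul_vMax_le_integral hm hT h1 h2 hp hK hδ hle
    fun x t ht => hgrow x 0 t le_rfl ht.1 ht.2
  have hmaxpos : ∀ t ∈ Ico 0 Tmax, 0 < vMax v t := fun t ht => by
    obtain ⟨⟨x, hx⟩, -⟩ := isGreatest_vMax hm hv ht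
    exact hx ▸ hv.pos x t ht
  have hmax : ∀ t s, 0 ≤ t → t ≤ s → s < Tmax → δ * vMax v t ≤ vMax v s := by
    intro t s h0 hts hs
    obtain ⟨⟨x, hx⟩, -⟩ := isGreatest_vMax hm hv ⟨h0, hts.trans_lt hs⟩
    rw [← hx]
    exact (hgrow x t s h0 hts hs).trans
      ((isGreatest_vMax hm hv ⟨h0.trans hts, hs⟩).2 (mem_range_self x))
  set L : ℝ → ℝ := fun s => ∫ x in 0..2 * m * Real.pi, v x s ^ (1 - p)
  have hL : ∀ t ∈ Ioo 0 Tmax, HasDerivAt L ((1 - p) * ∫ x in 0..2 * m * Real.pi, v x t) t :=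
    fun t htm => hv.hasDerivAt_integral_rpow hvxx h1 h2 ht htm
  -- For r ≥ t, -L'(r) = (p-1) ∫ v(·, r) ≥ (p-1) c v_max(r) ≥ (p-1) c δ v_max(t).
  set κ := (p - 1) * (c * δ)
  have hκ : 0 < κ := mul_pos (by linarith) (mul_pos hc hδ)
  have hdrop : ∀ t ∈ Ioo 0 Tmax, ∀ s ∈ Ico t Tmax, κ * vMax v t * (s - t) ≤ L t - L s := by
    intro t ht0 s hs
    have hsub : Icc t s ⊆ Ioo 0 Tmax := fun r hr => ⟨ht0.1.trans_le hr.1, hr.2.trans_lt hs.2⟩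
    have := (convex_Icc t s).image_sub_le_mul_sub_of_deriv_le (f := L) (C := -(κ * vMax v t))
      (fun r hr => (hL r (hsub hr)).continuousAt.continuousWithinAt)
      (fun r hr => (hL r (hsub (interior_subset hr))).differentiableAt.differentiableWithinAt)
      (fun r hr => by
        have hr' := interior_subset hr
        have hr0 := hsub hr'
        rw [(hL r hr0).deriv]
        have e1 := hint r ⟨hr0.1.le, hr0.2⟩
        have e2 := mul_le_mul_of_nonneg_left (hmax t r ht0.1.le hr'.1 hr0.2) hc.le
        have e3 := mul_le_mul_of_nonneg_left (e2.trans e1) (by linarith : 0 ≤ p - 1)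
        have : κ * vMax v t = (p - 1) * (c * (δ * vMax v t)) := by ring
        linarith)
      t ⟨le_rfl, hs.1⟩ s ⟨hs.1, le_rfl⟩ hs.1
    linarith
  have hLpos : ∀ t ∈ Ioo 0 Tmax, 0 ≤ L t := fun t htm =>
    intervalIntegral.integral_nonneg (by positivity)
      fun x _ => (Real.rpow_pos_of_pos (hv.pos x t ⟨htm.1.le, htm.2⟩) _).le
  have hmono : MonotoneOn (fun t => -L t) (Ioo 0 Tmax) := by
    intro t htm s hsm hts
    have h3 := hdrop t htm s ⟨hts, hsm.2⟩
    have := mul_nonneg (mul_nonneg hκ.le (hmaxpos t ⟨htm.1.le, htm.2⟩).le) (sub_nonneg.2 hts)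
    simp only
    linarith
  have hlim := hmono.tendsto_nhdsWithin_Ioo_left (nonempty_Ioo.2 hT)
    ⟨0, by rintro - ⟨t, htm, rfl⟩; simpa using hLpos t htm⟩
  -- The limit of L at Tmax is -ℓ, hence L t + ℓ is the drop of L still to come.
  set ℓ := sSup ((fun t => -L t) '' Ioo 0 Tmax)
  have hbound : ∀ t ∈ Ioo 0 Tmax, (Tmax - t) * vMax v t ≤ (L t + ℓ) / κ := by
    intro t htm
    have hl : Tendsto (fun s => κ * vMax v t * (s - t)) (𝓝[<] Tmax)
        (𝓝 (κ * vMax v t * (Tmax - t))) :=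
      (Continuous.tendsto (by fun_prop) Tmax).mono_left nhdsWithin_le_nhds
    have h3 := le_of_tendsto_of_tendsto hl (hlim.const_add (L t)) (by
      filter_upwards [Ioo_mem_nhdsLT htm.2] with s hs
      linarith [hdrop t htm s ⟨hs.1.le, hs.2⟩])
    rw [le_div_iff₀ hκ]
    linarith
  have hzero : Tendsto (fun t => (L t + ℓ) / κ) (𝓝[<] Tmax) (𝓝 0) := by
    have := (hlim.neg.add_const ℓ).div_const κ
    simpa using this
  refine tendsto_of_tendsto_of_tendsto_of_le_of_le' tendsto_const_nhds hzero ?_ ?_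
  · filter_upwards [Ioo_mem_nhdsLT hT] with t htm
    exact mul_nonneg (by linarith [htm.2]) (hmaxpos t ⟨htm.1.le, htm.2⟩).le
  · filter_upwards [Ioo_mem_nhdsLT hT] with t htm using hbound t htm
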